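/- Let $d \ge 0$ and $n \ge 2$ be integers, and let $D = (u^{(1)},\dots,u^{(n)})$ be a database of $n$ items $u^{(j)} \in \{0,1\}^d$ (repetitions allowed). For $q, u \in \{0,1\}^d$ let $P(q,u) = 1 - \bigvee_{i\,:\,u_i = 0} q_i \in \{0,1\}$ be the monotone conjunction predicate (the empty disjunction being $0$). For $t \in [0,1]$ define $f^D_t : \{0,1\}^d \to \{0,1\}$ by $f^D_t(q) = 1$ if $\frac1n \sum_{j=1}^n P(q,u^{(j)}) \ge t$, and $f^D_t(q) = 0$ otherwise. A function $f : \{0,1\}^d \to \{0,1\}$ has a polynomial threshold function (PTF) of degree at most $a$ over $\{0,1\}^d$ if there is a real polynomial $A(q_1,\dots,q_d)$ of total degree at most $a$ such that, for every $q \in \{0,1\}^d$, $f(q) = 1$ if $A(q) \ge 0$ and $f(q) = 0$ if $A(q) < 0$. Then $f^D_t$ has a PTF of degree $O\big(d^{1/3} (\log n)^{2/3}\big)$ over the whole hypercube $\{0,1\}^d$. That is, there is an absolute constant $C > 0$ such that for all integers $d \ge 0$ and $n \ge 2$, every database $D \in (\{0,1\}^d)^n$ and every $t \in [0,1]$, the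 function $f^D_t$ has a PTF of degree at most $C\, d^{1/3} (\log n)^{2/3}$ over $\{0,1\}^d$. -/

import Mathlib

/-- The Boolean hypercube `{0,1}^d`, with `true` for `1` and `false` for `0`.
It is both the data universe and the set of query descriptions. -/
abbrev BoolCube (d : ℕ) : Type := Fin d → Bool

/-- The real number `0` or `1` that a bit stands for. -/
def bitToReal (b : Bool) : ℝ := if b then 1 else 0

/-- The monotone conjunction predicate `P(q, u) = 1 - ⋁_{i : u_i = 0} q_i`. -/
def monotoneConj {d : ℕ} (q u : BoolCube d) : Bool :=
  !decide (∃ i : Fin d, u i = false ∧ q i = true)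

/-- The counting query `f^D(q) = (1/n) ∑_{u ∈ D} P(q, u)` for a predicate `P` and a database
`D` of size `n`, that is, an `n`-tuple of items. -/
noncomputable def countingQuery {Q U : Type*} (P : Q → U → Bool) {n : ℕ} (D : Fin n → U)
    (q : Q) : ℝ :=
  (1 / (n : ℝ)) * ∑ j : Fin n, bitToReal (P q (D j))

/-- The thresholded counting query `f^D_t(q) = 𝕀{f^D(q) ≥ t}`. -/
noncomputable def thresholdQuery {Q U : Type*} (P : Q → U → Bool) {n : ℕ} (D : Fin n → U)
    (t : ℝ) (q : Q) : Bool :=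
  decide (countingQuery P D q ≥ t)

/-- The sign function with values in `{0,1}`: it is `1` if `z ≥ 0` and `0` if `z < 0`. -/
noncomputable def boolSign (z : ℝ) : Bool := decide (0 ≤ z)

/-- `f` has a polynomial threshold function of degree (at most) `a` over `X ⊆ {0,1}^d`: there is a
real polynomial `A(q_1, …, q_d)` of total degree at most `a` with `f(q) = sign(A(q))` on `X`. -/
def HasPTF {d : ℕ} (X : Set (BoolCube d)) (f : BoolCube d → Bool) (a : ℕ) : Prop :=
  ∃ A : MvPolynomial (Fin d) ℝ, A.totalDegree ≤ a ∧
    ∀ q ∈ X, f q = boolSign (MvPolynomial.eval (fun i => bitToReal (q i)) A)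

/-! A conjunction depends only on the number of ones of `q` among at most `k` coordinates when it
has width at most `k`. A Chebyshev-type univariate polynomial of degree O(√(k log n)) in that number
approximates it within 1/(4n); summing over the database gives the integer count within 1/4, hence a
threshold polynomial (`exists_disjunction_approx`, `hasStrictPTF_of_approx`).

Wider conjunctions are removed by a decision tree that queries a variable lying in at least a k/d
fraction of them (`hasStrictPTF_of_short`). The answer 1 falsifies all of these, so about (d/k) log
n such answers leave no wide conjunction. Only answers 1 cost degree (`HasStrictPTF.branch`): in
M·q_i·A₁ + A₀ a large M lets A₁ decide the sign when q_i = 1, while A₀ is left unmultiplied. Taking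
k ≈ d^(2/3) (log n)^(1/3) balances the two costs. -/

/-! ### Univariate approximation of a disjunction -/

-- The increments of `T` in the index grow by 2(x - 1)T_{m+1} ≥ 2(x - 1) at each step, so the
-- induction carries the increment along with the value.
open Polynomial in
theorem one_add_sq_mul_le_eval_T {x : ℝ} (hx : 1 ≤ x) (m : ℕ) :
    1 + (m : ℝ) ^ 2 * (x - 1) ≤ (Chebyshev.T ℝ m).eval x := by
  suffices h : 1 + (m : ℝ) ^ 2 * (x - 1) ≤ (Chebyshev.T ℝ m).eval x ∧
      (2 * m + 1) * (x - 1) ≤ (Chebyshev.T ℝ (m + 1 : ℤ)).eval x - (Chebyshev.T ℝ m).eval x from h.1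
  induction m with
  | zero => simp
  | succ m ih =>
    obtain ⟨h1, h2⟩ := ih
    have h3 := Chebyshev.one_le_eval_T_real (m + 1 : ℤ) hx
    have h4 := congrArg (Polynomial.eval x) (Chebyshev.T_add_two ℝ (m : ℤ))
    simp only [eval_sub, eval_mul, eval_X, eval_ofNat] at h4
    push_cast
    rw [show (m : ℤ) + 1 + 1 = m + 2 by ring, h4]
    constructor <;> nlinarith

open Polynomial in
/-- A polynomial of degree `O(√(k / i))`, bounded by `1` on `[0, k]`, with value `1` at `0` and
vanishing at `i`. -/
theorem exists_bounded_poly_vanishing (k i : ℕ) (hi : 0 < i) (hik : i ≤ k) :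
    ∃ p : ℝ[X], p.natDegree ≤ ⌈√((k : ℝ) / i)⌉₊ ∧ p.eval 0 = 1 ∧ p.eval (i : ℝ) = 0 ∧
      ∀ x : ℝ, 0 ≤ x → x ≤ k → |p.eval x| ≤ 1 := by
  set m : ℕ := ⌈√((k : ℝ) / i)⌉₊ with hm
  have hi' : (0 : ℝ) < i := by exact_mod_cast hi
  have hk' : (0 : ℝ) < k := by exact_mod_cast hi.trans_le hik
  have hs : 0 < √((k : ℝ) / i) := by positivity
  have hle : √((k : ℝ) / i) ≤ m := Nat.le_ceil _
  have hm0 : (0 : ℝ) < m := hs.trans_le hle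
  have hsq : (k : ℝ) / i ≤ (m : ℝ) ^ 2 := by
    rw [← Real.sq_sqrt (by positivity : (0 : ℝ) ≤ (k : ℝ) / i)]
    gcongr
  -- The angle 2θ = π/(2m) gives the largest zero of T_m. The affine map below sends 0 to 1 and `i`
  -- to cos 2θ; `hsin` keeps the image of [0, k] inside [-1, 1].
  set θ : ℝ := Real.pi / (4 * m) with hθ
  have hθ0 : 0 ≤ θ := by positivity
  have hθ1 : θ ≤ 1 / m := by
    rw [hθ, div_le_div_iff₀ (by positivity) hm0]
    nlinarith [Real.pi_le_four]
  have hsin : Real.sin θ ^ 2 * k ≤ i := by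
    have h1 : Real.sin θ ^ 2 ≤ (1 / m) ^ 2 := by
      rw [sq_le_sq]
      exact (Real.abs_sin_le_abs.trans_eq (abs_of_nonneg hθ0)).trans
        (hθ1.trans (le_abs_self _))
    have h2 : (k : ℝ) ≤ m ^ 2 * i := (div_le_iff₀ hi').1 hsq
    calc Real.sin θ ^ 2 * k ≤ (1 / m) ^ 2 * (m ^ 2 * i) := by gcongr
      _ = (i : ℝ) := by field_simp
  refine ⟨(Chebyshev.T ℝ m).comp (1 - C (2 * Real.sin θ ^ 2 / i) * X), ?_, ?_, ?_, ?_⟩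
  · refine natDegree_comp_le.trans ?_
    rw [Chebyshev.natDegree_T, Int.natAbs_natCast]
    refine (Nat.mul_le_mul_left m ?_).trans_eq (mul_one m)
    compute_degree
  · simp [Chebyshev.T_eval_one]
  · have : (1 - 2 * Real.sin θ ^ 2 / i * i : ℝ) = Real.cos (2 * θ) := by
      rw [Real.cos_two_mul, Real.cos_sq']; field_simp; ring
    simp only [eval_comp, eval_sub, eval_one, eval_mul, eval_C, eval_X, this]
    rw [Chebyshev.T_real_cos]
    have : ((m : ℤ) : ℝ) * (2 * θ) = Real.pi / 2 := by
      rw [hθ]; push_cast; field_simp; ring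
    rw [this, Real.cos_pi_div_two]
  · intro x hx0 hxk
    simp only [eval_comp, eval_sub, eval_one, eval_mul, eval_C, eval_X]
    refine Chebyshev.abs_eval_T_real_le_one _ ?_
    have h1 : 0 ≤ 2 * Real.sin θ ^ 2 / i * x := by positivity
    have h2 : 2 * Real.sin θ ^ 2 / i * x ≤ 2 := by
      rw [div_mul_eq_mul_div, div_le_iff₀ hi']
      nlinarith [sq_nonneg (Real.sin θ)]
    rw [abs_le]; constructor <;> linarith

open Polynomial in
/-- A polynomial of degree `O(√(k / s))`, bounded by `1/2` on `[s, k]`, with value `1` at `0`. -/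
theorem exists_half_bounded_poly (k s : ℕ) (hs : 0 < s) (hsk : s ≤ k) :
    ∃ p : ℝ[X], p.natDegree ≤ ⌈√((k : ℝ) / s)⌉₊ ∧ p.eval 0 = 1 ∧
      ∀ x : ℝ, s ≤ x → x ≤ k → |p.eval x| ≤ 1 / 2 := by
  set m : ℕ := ⌈√((k : ℝ) / s)⌉₊ with hm
  have hs' : (0 : ℝ) < s := by exact_mod_cast hs
  have hk' : (0 : ℝ) < k := by exact_mod_cast hs.trans_le hsk
  have hsq : (k : ℝ) / s ≤ (m : ℝ) ^ 2 := by
    rw [← Real.sq_sqrt (by positivity : (0 : ℝ) ≤ (k : ℝ) / s)]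
    gcongr
    exact Nat.le_ceil _
  -- The map x ↦ 1 + c - 2x/k sends [s, k] into [-1, 1] and 0 to 1 + c, where T_m is at least 1 +
  -- m²c ≥ 3.
  set c : ℝ := 2 * s / k with hc
  have hc0 : 0 < c := by positivity
  set τ : ℝ := (Chebyshev.T ℝ m).eval (1 + c) with hτ
  have hτ2 : 2 ≤ τ := by
    have h := one_add_sq_mul_le_eval_T (x := 1 + c) (by linarith) m
    have h1 : (k : ℝ) / s * c ≤ m ^ 2 * c := by gcongr
    have h2 : (k : ℝ) / s * c = 2 := by rw [hc]; field_simp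
    linarith
  refine ⟨C τ⁻¹ * (Chebyshev.T ℝ m).comp (C (1 + c) - C (2 / (k : ℝ)) * X), ?_, ?_, ?_⟩
  · refine (natDegree_C_mul_le _ _).trans (natDegree_comp_le.trans ?_)
    rw [Chebyshev.natDegree_T, Int.natAbs_natCast]
    refine (Nat.mul_le_mul_left m ?_).trans_eq (mul_one m)
    compute_degree
  · simp only [eval_comp, eval_sub, eval_mul, eval_C, eval_X, mul_zero, sub_zero]
    exact inv_mul_cancel₀ (by linarith)
  · intro x hx0 hxk
    simp only [eval_comp, eval_sub, eval_mul, eval_C, eval_X, abs_mul]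
    have h1 : |(Chebyshev.T ℝ m).eval (1 + c - 2 / k * x)| ≤ 1 := by
      refine Chebyshev.abs_eval_T_real_le_one _ ?_
      have h1 : c ≤ 2 / k * x := by rw [hc, div_mul_eq_mul_div]; gcongr
      have h2 : 2 / k * x ≤ 2 := by
        rw [div_mul_eq_mul_div, div_le_iff₀ hk']; linarith
      rw [abs_le]; constructor <;> linarith
    have h2 : |τ⁻¹| ≤ 1 / 2 := by
      rw [abs_inv, abs_of_nonneg (by linarith), one_div]
      exact inv_anti₀ two_pos hτ2
    calc _ ≤ (1 / 2 : ℝ) * 1 := mul_le_mul h2 h1 (abs_nonneg _) (by norm_num)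
      _ = 1 / 2 := mul_one _

theorem natCeil_le_two_mul {x : ℝ} (hx : 1 ≤ x) : (⌈x⌉₊ : ℝ) ≤ 2 * x := by
  linarith [Nat.ceil_lt_add_one (zero_le_one.trans hx)]

theorem sum_one_div_sqrt_le (s : ℕ) :
    ∑ i ∈ Finset.range s, 1 / √((i : ℝ) + 1) ≤ 2 * √(s : ℝ) := by
  induction s with
  | zero => simp
  | succ s ih =>
    rw [Finset.sum_range_succ]
    push_cast
    have h0 : 0 < √((s : ℝ) + 1) := by positivity
    have h1 : √((s : ℝ) + 1) ^ 2 = s + 1 := Real.sq_sqrt (by positivity)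
    have h2 : √(s : ℝ) ^ 2 = s := Real.sq_sqrt (by positivity)
    have h3 : 1 / √((s : ℝ) + 1) ≤ 2 * √((s : ℝ) + 1) - 2 * √(s : ℝ) := by
      rw [div_le_iff₀ h0]
      nlinarith [sq_nonneg (√((s : ℝ) + 1) - √(s : ℝ))]
    linarith

open Polynomial in
/-- Approximation of the disjunction of `k` bits up to error `2⁻ˢ` in degree `O(√(k s))`. -/
theorem exists_disjunction_approx (k s : ℕ) (hs : 0 < s) (hsk : s ≤ k) :
    ∃ p : ℝ[X], (p.natDegree : ℝ) ≤ 6 * √((k : ℝ) * s) ∧ p.eval 0 = 1 ∧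
      ∀ x : ℕ, 0 < x → x ≤ k → |p.eval (x : ℝ)| ≤ (1 / 2) ^ s := by
  have hr : ∀ i : ℕ, ∃ p : ℝ[X], i < s → (p.natDegree ≤ ⌈√((k : ℝ) / (i + 1 : ℕ))⌉₊ ∧
      p.eval 0 = 1 ∧ p.eval ((i + 1 : ℕ) : ℝ) = 0 ∧
      ∀ x : ℝ, 0 ≤ x → x ≤ k → |p.eval x| ≤ 1) := fun i => by
    by_cases h : i < s
    · obtain ⟨p, hp⟩ := exists_bounded_poly_vanishing k (i + 1) i.succ_pos (by omega)
      exact ⟨p, fun _ => hp⟩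
    · exact ⟨0, fun h' => absurd h' h⟩
  choose r hr using hr
  obtain ⟨w, hwd, hw0, hw⟩ := exists_half_bounded_poly k s hs hsk
  have hceil : ∀ i : ℕ, 0 < i → i ≤ s →
      (⌈√((k : ℝ) / i)⌉₊ : ℝ) ≤ 2 * (√(k : ℝ) * (1 / √(i : ℝ))) := fun i hi his => by
    have hi' : (0 : ℝ) < i := by exact_mod_cast hi
    have hik : (i : ℝ) ≤ k := by exact_mod_cast his.trans hsk
    rw [mul_one_div, ← Real.sqrt_div' _ hi'.le]
    refine natCeil_le_two_mul (Real.one_le_sqrt.2 ?_)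
    rwa [le_div_iff₀ hi', one_mul]
  -- The product vanishes at 1, …, s and is at most 1 in absolute value on [0, k]; beyond s the
  -- factor `w ^ s` supplies 2⁻ˢ. The degrees √(k/i) sum to O(√(ks)), the same order as s√(k/s).
  refine ⟨(∏ i ∈ Finset.range s, r i) * w ^ s, ?_, ?_, ?_⟩
  · have h1 : ((∏ i ∈ Finset.range s, r i) * w ^ s).natDegree ≤
        ∑ i ∈ Finset.range s, ⌈√((k : ℝ) / (i + 1 : ℕ))⌉₊ + s * ⌈√((k : ℝ) / s)⌉₊ := by
      refine natDegree_mul_le.trans (add_le_add ?_ ?_)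
      · refine (natDegree_prod_le _ _).trans (Finset.sum_le_sum fun i hi => ?_)
        exact (hr i (Finset.mem_range.1 hi)).1
      · exact natDegree_pow_le.trans (Nat.mul_le_mul_left s hwd)
    have h2 : ∑ i ∈ Finset.range s, (⌈√((k : ℝ) / (i + 1 : ℕ))⌉₊ : ℝ) ≤
        2 * (√(k : ℝ) * (2 * √(s : ℝ))) := by
      refine le_trans (Finset.sum_le_sum fun i hi =>
        hceil (i + 1) i.succ_pos (Finset.mem_range.1 hi)) ?_
      rw [← Finset.mul_sum, ← Finset.mul_sum]
      gcongr
      simpa using sum_one_div_sqrt_le s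
    have h3 : (s : ℝ) * ⌈√((k : ℝ) / s)⌉₊ ≤ 2 * (√(k : ℝ) * √(s : ℝ)) := by
      have h := mul_le_mul_of_nonneg_left (hceil s hs le_rfl) (Nat.cast_nonneg (α := ℝ) s)
      refine h.trans_eq ?_
      have hs' : (0 : ℝ) < s := by exact_mod_cast hs
      have : √(s : ℝ) * √(s : ℝ) = s := Real.mul_self_sqrt hs'.le
      have h0 : √(s : ℝ) ≠ 0 := by positivity
      field_simp
      linear_combination (-√(k : ℝ)) * this
    rw [Real.sqrt_mul (Nat.cast_nonneg k)]
    have h4 : (((∏ i ∈ Finset.range s, r i) * w ^ s).natDegree : ℝ) ≤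
        ∑ i ∈ Finset.range s, (⌈√((k : ℝ) / (i + 1 : ℕ))⌉₊ : ℝ) + s * ⌈√((k : ℝ) / s)⌉₊ := by
      exact_mod_cast h1
    linarith
  · rw [eval_mul, eval_pow, hw0, one_pow, mul_one, eval_prod]
    exact Finset.prod_eq_one fun i hi => (hr i (Finset.mem_range.1 hi)).2.1
  · intro x hx0 hxk
    rw [eval_mul, eval_pow, eval_prod, abs_mul, abs_pow, Finset.abs_prod]
    rcases le_or_gt x s with hxs | hxs
    · obtain ⟨i, rfl⟩ : ∃ i, x = i + 1 := ⟨x - 1, by omega⟩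
      rw [Finset.prod_eq_zero (Finset.mem_range.2 hxs : i ∈ Finset.range s)
        (by rw [(hr i hxs).2.2.1, abs_zero]), zero_mul]
      positivity
    · have h1 : ∏ i ∈ Finset.range s, |(r i).eval (x : ℝ)| ≤ 1 :=
        Finset.prod_le_one (fun _ _ => abs_nonneg _) fun i hi =>
          (hr i (Finset.mem_range.1 hi)).2.2.2 _ (Nat.cast_nonneg x) (by exact_mod_cast hxk)
      have h2 : |w.eval (x : ℝ)| ^ s ≤ (1 / 2) ^ s :=
        pow_le_pow_left₀ (abs_nonneg _) (hw _ (by exact_mod_cast hxs.le) (by exact_mod_cast hxk)) s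
      calc _ ≤ 1 * (1 / 2 : ℝ) ^ s := mul_le_mul h1 h2 (by positivity) zero_le_one
        _ = _ := one_mul _

/-! ### Strict threshold polynomials and branching -/

/-- `f` is the sign of a polynomial of total degree at most `a` without zeros on the cube. -/
def HasStrictPTF {d : ℕ} (f : BoolCube d → Prop) (a : ℕ) : Prop :=
  ∃ A : MvPolynomial (Fin d) ℝ, A.totalDegree ≤ a ∧
    ∀ q, (f q → 0 < MvPolynomial.eval (fun i => bitToReal (q i)) A) ∧
      (¬ f q → MvPolynomial.eval (fun i => bitToReal (q i)) A < 0)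

theorem HasStrictPTF.mono {d : ℕ} {f : BoolCube d → Prop} {a b : ℕ} (h : HasStrictPTF f a)
    (hab : a ≤ b) : HasStrictPTF f b :=
  let ⟨A, hA, hf⟩ := h
  ⟨A, hA.trans hab, hf⟩

theorem HasStrictPTF.hasPTF {d : ℕ} {f : BoolCube d → Prop} [DecidablePred f] {a : ℕ}
    (h : HasStrictPTF f a) (X : Set (BoolCube d)) : HasPTF X (fun q => decide (f q)) a := by
  obtain ⟨A, hA, hf⟩ := h
  refine ⟨A, hA, fun q _ => ?_⟩
  unfold boolSign
  by_cases hq : f q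
  · simp [hq, ((hf q).1 hq).le]
  · simp [hq, (hf q).2 hq]

/-- Branching on one variable raises the degree of the branch `q i = 1` by one. -/
theorem HasStrictPTF.branch {d : ℕ} {f f₀ f₁ : BoolCube d → Prop} {a : ℕ} (i : Fin d)
    (h₀ : HasStrictPTF f₀ (a + 1)) (h₁ : HasStrictPTF f₁ a)
    (hf₀ : ∀ q, q i = false → (f q ↔ f₀ q)) (hf₁ : ∀ q, q i = true → (f q ↔ f₁ q)) :
    HasStrictPTF f (a + 1) := by
  obtain ⟨A₀, hd₀, hA₀⟩ := h₀
  obtain ⟨A₁, hd₁, hA₁⟩ := h₁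
  set e : BoolCube d → MvPolynomial (Fin d) ℝ → ℝ :=
    fun q A => MvPolynomial.eval (fun i => bitToReal (q i)) A with he
  have hne : ∀ q, 0 < |e q A₁| := fun q => abs_pos.2 <| by
    by_cases h : f₁ q
    · exact ((hA₁ q).1 h).ne'
    · exact ((hA₁ q).2 h).ne
  -- Strictness keeps A₁ away from zero on the finite cube, so one `M` makes M·A₁ dominate A₀
  -- everywhere.
  obtain ⟨M, hM⟩ : ∃ M : ℝ, ∀ q, |e q A₀| / |e q A₁| < M := by
    obtain ⟨M, hM⟩ := (Set.finite_range fun q => |e q A₀| / |e q A₁|).bddAbove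
    exact ⟨M + 1, fun q => (hM ⟨q, rfl⟩).trans_lt (lt_add_one M)⟩
  refine ⟨MvPolynomial.X i * (MvPolynomial.C M * A₁) + A₀, ?_, fun q => ?_⟩
  · refine (MvPolynomial.totalDegree_add _ _).trans (max_le ?_ hd₀)
    have h1 := MvPolynomial.totalDegree_mul (MvPolynomial.X i) (MvPolynomial.C M * A₁)
    have h2 := MvPolynomial.totalDegree_mul (MvPolynomial.C M) A₁
    rw [MvPolynomial.totalDegree_X] at h1
    rw [MvPolynomial.totalDegree_C] at h2
    omega
  · rw [map_add, map_mul, map_mul, MvPolynomial.eval_X, MvPolynomial.eval_C]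
    cases hq : q i
    · rw [hf₀ q hq]
      simpa [bitToReal] using hA₀ q
    · rw [hf₁ q hq]
      have h1 : |e q A₀| < M * |e q A₁| := (div_lt_iff₀ (hne q)).1 (hM q)
      simp only [bitToReal, if_true, one_mul]
      refine ⟨fun h => ?_, fun h => ?_⟩
      · have h2 : |e q A₁| = e q A₁ := abs_of_pos ((hA₁ q).1 h)
        have h3 := neg_abs_le (e q A₀)
        rw [h2] at h1
        change 0 < M * e q A₁ + e q A₀
        linarith
      · have h2 : |e q A₁| = - e q A₁ := abs_of_neg ((hA₁ q).2 h)
        have h3 := le_abs_self (e q A₀)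
        rw [h2] at h1
        change M * e q A₁ + e q A₀ < 0
        linarith

/-! ### Counting short conjunctions -/

/-- The number of indices `j ∈ J` for which all the bits of `q` in `S j` vanish. -/
def conjCount {ι : Type*} {d : ℕ} (J : Finset ι) (S : ι → Finset (Fin d)) (q : BoolCube d) : ℕ :=
  (J.filter fun j => ∀ i ∈ S j, q i = false).card

theorem totalDegree_aeval_le {d : ℕ} (p : Polynomial ℝ) (B : MvPolynomial (Fin d) ℝ)
    (hB : B.totalDegree ≤ 1) : (Polynomial.aeval B p).totalDegree ≤ p.natDegree := by
  rw [Polynomial.aeval_eq_sum_range]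
  refine MvPolynomial.totalDegree_finsetSum_le fun i hi => ?_
  refine (MvPolynomial.totalDegree_smul_le _ _).trans ((MvPolynomial.totalDegree_pow _ _).trans ?_)
  have := Finset.mem_range.1 hi
  nlinarith

theorem hasStrictPTF_of_approx {ι : Type*} {d : ℕ} (n k : ℕ) (hn : 0 < n) (p : Polynomial ℝ)
    (hp0 : p.eval 0 = 1)
    (hp : ∀ x : ℕ, 0 < x → x ≤ k → |p.eval (x : ℝ)| ≤ 1 / (4 * n))
    (J : Finset ι) (S : ι → Finset (Fin d)) (hJ : J.card ≤ n) (hS : ∀ j ∈ J, (S j).card ≤ k)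
    (θ : ℝ) : HasStrictPTF (fun q => θ ≤ conjCount J S q) p.natDegree := by
  -- The count is an integer, so the cut can be placed at ⌈θ⌉ - 1/2; its distance 1/2 to every
  -- integer exceeds the total error 1/4.
  refine ⟨∑ j ∈ J, Polynomial.aeval (∑ i ∈ S j, MvPolynomial.X i : MvPolynomial (Fin d) ℝ) p
    + MvPolynomial.C (1 / 2 - (⌈θ⌉ : ℝ)), ?_, fun q => ?_⟩
  · refine (MvPolynomial.totalDegree_add _ _).trans (max_le ?_ ?_)
    · refine MvPolynomial.totalDegree_finsetSum_le fun j _ => totalDegree_aeval_le p _ ?_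
      exact MvPolynomial.totalDegree_finsetSum_le fun i _ => (MvPolynomial.totalDegree_X i).le
    · rw [MvPolynomial.totalDegree_C]; exact Nat.zero_le _
  · have hterm : ∀ j ∈ J, |p.eval (∑ i ∈ S j, bitToReal (q i)) -
        (if ∀ i ∈ S j, q i = false then 1 else 0 : ℝ)| ≤ 1 / (4 * n) := fun j hj => by
      have hsum : ∑ i ∈ S j, bitToReal (q i) = ((S j).filter fun i => q i = true).card := by
        simp [bitToReal]
      by_cases h : ∀ i ∈ S j, q i = false
      · have h0 : (S j).filter (fun i => q i = true) = ∅ :=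
          Finset.filter_eq_empty_iff.2 fun i hi => by simp [h i hi]
        rw [if_pos h, hsum, h0, Finset.card_empty, Nat.cast_zero, hp0, sub_self, abs_zero]
        positivity
      · rw [if_neg h, sub_zero, hsum]
        refine hp _ ?_ ((Finset.card_filter_le _ _).trans (hS j hj))
        push Not at h
        obtain ⟨i, hi, hqi⟩ := h
        exact Finset.card_pos.2 ⟨i, Finset.mem_filter.2 ⟨hi, by simpa using hqi⟩⟩
    have hev : MvPolynomial.eval (fun i => bitToReal (q i))
        (∑ j ∈ J, Polynomial.aeval (∑ i ∈ S j, MvPolynomial.X i : MvPolynomial (Fin d) ℝ) p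
          + MvPolynomial.C (1 / 2 - (⌈θ⌉ : ℝ))) =
        ∑ j ∈ J, p.eval (∑ i ∈ S j, bitToReal (q i)) + (1 / 2 - (⌈θ⌉ : ℝ)) := by
      rw [map_add, map_sum, MvPolynomial.eval_C]
      congr 1
      refine Finset.sum_congr rfl fun j _ => ?_
      rw [Polynomial.aeval_def, Polynomial.hom_eval₂, Polynomial.eval, map_sum]
      congr 1
      · ext x; simp
      · simp
    have happ : |∑ j ∈ J, p.eval (∑ i ∈ S j, bitToReal (q i)) - (conjCount J S q : ℝ)| ≤ 1 / 4 := by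
      have hc : (conjCount J S q : ℝ) =
          ∑ j ∈ J, (if ∀ i ∈ S j, q i = false then 1 else 0 : ℝ) := by
        simp [conjCount]
      rw [hc, ← Finset.sum_sub_distrib]
      refine (Finset.abs_sum_le_sum_abs _ _).trans ((Finset.sum_le_sum hterm).trans ?_)
      have hn' : (0 : ℝ) < n := by exact_mod_cast hn
      have hJ' : (J.card : ℝ) ≤ n := by exact_mod_cast hJ
      rw [Finset.sum_const, nsmul_eq_mul, mul_one_div, div_le_div_iff₀ (by positivity) (by norm_num)]
      linarith
    rw [hev]
    have hθ : θ ≤ (conjCount J S q : ℝ) ↔ ⌈θ⌉ ≤ (conjCount J S q : ℤ) := by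
      rw [Int.ceil_le, Int.cast_natCast]
    rw [abs_le] at happ
    refine ⟨fun h => ?_, fun h => ?_⟩
    · have : (⌈θ⌉ : ℝ) ≤ conjCount J S q := by exact_mod_cast hθ.1 h
      linarith
    · have h' : (conjCount J S q : ℤ) + 1 ≤ ⌈θ⌉ := by
        have := (not_congr hθ).1 h
        omega
      have : (conjCount J S q : ℝ) + 1 ≤ ⌈θ⌉ := by exact_mod_cast h'
      linarith

/-! ### Eliminating long conjunctions -/

/-- Some variable occurs in at least the average number of the sets `S j`. -/
theorem exists_frequent_variable {ι : Type*} {d : ℕ} (L : Finset ι) (S : ι → Finset (Fin d))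
    (k : ℕ) (hL : L.Nonempty) (hS : ∀ j ∈ L, k < (S j).card) :
    ∃ i : Fin d, k * L.card < d * (L.filter fun j => i ∈ S j).card := by
  by_contra! h
  have h1 : ∑ i : Fin d, (L.filter fun j => i ∈ S j).card = ∑ j ∈ L, (S j).card := by
    simp only [Finset.card_filter]
    rw [Finset.sum_comm]
    simp
  have h2 : k * L.card < ∑ j ∈ L, (S j).card := by
    rw [mul_comm, ← smul_eq_mul, ← Finset.sum_const]
    exact Finset.sum_lt_sum_of_nonempty hL hS
  have h3 : d * ∑ i : Fin d, (L.filter fun j => i ∈ S j).card ≤ d * (k * L.card) := by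
    rw [Finset.mul_sum]
    refine (Finset.sum_le_sum fun i _ => h i).trans ?_
    simp
  obtain ⟨j, hj⟩ := hL
  have hd : 0 < d := by
    have := (hS j hj).trans_le (Finset.card_le_univ (S j))
    rw [Fintype.card_fin] at this
    omega
  rw [h1] at h3
  exact absurd (Nat.le_of_mul_le_mul_left h3 hd) (not_le.2 h2)

/-- Killing long conjunctions by branching on frequent variables. -/
theorem hasStrictPTF_of_short {ι : Type*} {d : ℕ} (n k l : ℕ) (θ : ℝ)
    (hshort : ∀ (J : Finset ι) (S : ι → Finset (Fin d)), J.card ≤ n → (∀ j ∈ J, (S j).card ≤ k) →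
      HasStrictPTF (fun q => θ ≤ conjCount J S q) l) :
    ∀ (N : ℕ) (J : Finset ι) (S : ι → Finset (Fin d)) (r : ℕ), ∑ j ∈ J, (S j).card ≤ N →
      J.card ≤ n → ((J.filter fun j => k < (S j).card).card : ℝ) * (1 - k / d) ^ r < 1 →
      HasStrictPTF (fun q => θ ≤ conjCount J S q) (r + l) := by
  classical
  intro N
  -- Induction on the total width, since the branch q_i = 0 need not lower `r` or the number of long
  -- conjunctions.
  induction N using Nat.strong_induction_on with
  | _ N ih =>
  intro J S r hN hJ hr
  rcases (J.filter fun j => k < (S j).card).eq_empty_or_nonempty with hL | hL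
  · refine (hshort J S hJ fun j hj => ?_).mono (Nat.le_add_left l r)
    exact not_lt.1 (Finset.filter_eq_empty_iff.1 hL hj)
  obtain ⟨i, hi⟩ := exists_frequent_variable _ S k hL fun j hj => (Finset.mem_filter.1 hj).2
  set L := J.filter fun j => k < (S j).card with hLdef
  have hkd : k < d := by
    obtain ⟨j, hj⟩ := hL
    have := (Finset.mem_filter.1 hj).2.trans_le (Finset.card_le_univ (S j))
    rwa [Fintype.card_fin] at this
  have hd : (0 : ℝ) < d := by exact_mod_cast (Nat.zero_le k).trans_lt hkd
  have hρ : (0 : ℝ) ≤ 1 - k / d := by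
    rw [sub_nonneg, div_le_one hd]; exact_mod_cast hkd.le
  have hLcard : (1 : ℝ) ≤ L.card := by exact_mod_cast Finset.card_pos.2 hL
  obtain ⟨r, rfl⟩ : ∃ r', r = r' + 1 := by
    refine Nat.exists_eq_succ_of_ne_zero fun h => ?_
    rw [h, pow_zero, mul_one] at hr
    linarith
  obtain ⟨j₀, hj₀⟩ : (L.filter fun j => i ∈ S j).Nonempty := by
    rw [← Finset.card_pos]
    exact Nat.pos_of_ne_zero fun h => by simp [h] at hi
  have hj₀J : j₀ ∈ J := (Finset.mem_filter.1 (Finset.mem_filter.1 hj₀).1).1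
  have hj₀S : i ∈ S j₀ := (Finset.mem_filter.1 hj₀).2
  rw [show r + 1 + l = (r + l) + 1 by ring]
  refine HasStrictPTF.branch i (f₀ := fun q => θ ≤ conjCount J (fun j => (S j).erase i) q)
    (f₁ := fun q => θ ≤ conjCount (J.filter fun j => i ∉ S j) S q) ?_ ?_ ?_ ?_
  -- Branch q_i = 0: erasing `i` shrinks the total width and spends none of the budget `r`.
  · rw [show r + l + 1 = (r + 1) + l by ring]
    refine ih (∑ j ∈ J, ((S j).erase i).card) ?_ J _ (r + 1) le_rfl hJ ?_
    · refine lt_of_lt_of_le (Finset.sum_lt_sum (fun j _ => Finset.card_erase_le) ?_) hN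
      exact ⟨j₀, hj₀J, Finset.card_erase_lt_of_mem hj₀S⟩
    · refine lt_of_le_of_lt (mul_le_mul_of_nonneg_right ?_ (pow_nonneg hρ _)) hr
      refine Nat.cast_le.2 (Finset.card_le_card fun j hj => ?_)
      rw [Finset.mem_filter] at hj ⊢
      exact ⟨hj.1, hj.2.trans_le Finset.card_erase_le⟩
  -- Branch q_i = 1: conjunctions containing `i` die, and the factor 1 - k/d gained on the long ones
  -- pays for one unit of `r`.
  · refine ih (∑ j ∈ J.filter fun j => i ∉ S j, (S j).card) ?_ _ S r le_rfl
      ((Finset.card_filter_le _ _).trans hJ) ?_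
    · refine lt_of_lt_of_le (Finset.sum_lt_sum_of_subset (Finset.filter_subset _ _) hj₀J ?_ ?_ ?_) hN
      · simp [hj₀S]
      · exact Finset.card_pos.2 ⟨i, hj₀S⟩
      · exact fun _ _ _ => Nat.zero_le _
    · have hsplit : (L.filter fun j => i ∈ S j).card + (L.filter fun j => i ∉ S j).card = L.card :=
        Finset.card_filter_add_card_filter_not _
      have hcomm : (J.filter fun j => i ∉ S j).filter (fun j => k < (S j).card) =
          L.filter fun j => i ∉ S j := Finset.filter_comm _ _ _
      rw [hcomm]
      have h1 : (k : ℝ) * L.card ≤ d * (L.filter fun j => i ∈ S j).card := by exact_mod_cast hi.le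
      have h2 : ((L.filter fun j => i ∈ S j).card : ℝ) + (L.filter fun j => i ∉ S j).card = L.card := by
        exact_mod_cast hsplit
      have h3 : ((L.filter fun j => i ∉ S j).card : ℝ) ≤ L.card * (1 - k / d) := by
        have : (k : ℝ) / d * L.card ≤ (L.filter fun j => i ∈ S j).card := by
          rw [div_mul_eq_mul_div, div_le_iff₀ hd]; linarith
        linarith
      refine lt_of_le_of_lt (mul_le_mul_of_nonneg_right h3 (pow_nonneg hρ _)) ?_
      rwa [mul_assoc, ← pow_succ']
  · intro q hq
    have : conjCount J S q = conjCount J (fun j => (S j).erase i) q := by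
      unfold conjCount
      congr 1
      refine Finset.filter_congr fun j _ => ⟨fun h i' hi' => h i' (Finset.mem_of_mem_erase hi'),
        fun h i' hi' => ?_⟩
      by_cases hii : i' = i
      · rw [hii, hq]
      · exact h i' (Finset.mem_erase.2 ⟨hii, hi'⟩)
    rw [this]
  · intro q hq
    have : conjCount J S q = conjCount (J.filter fun j => i ∉ S j) S q := by
      unfold conjCount
      rw [Finset.filter_filter]
      congr 1
      refine Finset.filter_congr fun j _ => ⟨fun h => ⟨fun hi => ?_, h⟩, fun h => h.2⟩
      simpa [hq] using h i hi
    rw [this]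

/-! ### Choice of parameters and conclusion -/

theorem thresholdQuery_eq {d n : ℕ} (hn : 0 < n) (D : Fin n → BoolCube d) (t : ℝ) :
    thresholdQuery (monotoneConj (d := d)) D t = fun q => decide (n * t ≤
      conjCount Finset.univ (fun j => Finset.univ.filter fun i => D j i = false) q) := by
  funext q
  have hn' : (0 : ℝ) < n := by exact_mod_cast hn
  have hc : ∑ j : Fin n, bitToReal (monotoneConj q (D j)) =
      conjCount Finset.univ (fun j => Finset.univ.filter fun i => D j i = false) q := by
    simp [conjCount, bitToReal, monotoneConj]
  unfold thresholdQuery countingQuery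
  rw [hc, decide_eq_decide, ge_iff_le, one_div, ← div_eq_inv_mul, le_div_iff₀' hn']

open Polynomial in
theorem exists_poly_vanishing_on_range (d : ℕ) :
    ∃ p : ℝ[X], p.natDegree ≤ d ∧ p.eval 0 = 1 ∧
      ∀ x : ℕ, 0 < x → x ≤ d → p.eval (x : ℝ) = 0 := by
  refine ⟨∏ i ∈ Finset.range d, (1 - C (1 / ((i : ℝ) + 1)) * X), ?_, ?_, fun x hx0 hxd => ?_⟩
  · refine (natDegree_prod_le _ _).trans ((Finset.sum_le_card_nsmul _ _ 1 fun i _ => ?_).trans ?_)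
    · compute_degree
    · simp
  · simp [eval_prod]
  · obtain ⟨i, rfl⟩ : ∃ i, x = i + 1 := ⟨x - 1, by omega⟩
    rw [eval_prod]
    refine Finset.prod_eq_zero (Finset.mem_range.2 hxd) ?_
    have : (i : ℝ) + 1 ≠ 0 := by positivity
    simp [this]

/-- The left side is at most 3 + log n / log 2, and log n ≥ log 2 absorbs the 3, giving 4 / log 2 <
6. -/
theorem clog_four_mul_le (n : ℕ) (hn : 2 ≤ n) :
    (Nat.clog 2 (4 * n) : ℝ) ≤ 6 * Real.log n := by
  have h1 : 2 ^ (Nat.clog 2 (4 * n) - 1) < 4 * n :=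
    Nat.pow_pred_clog_lt_self one_lt_two (by omega)
  have hpos : 0 < Nat.clog 2 (4 * n) := Nat.clog_pos one_lt_two (by omega)
  set l := Nat.clog 2 (4 * n) with hl
  obtain ⟨m, hm⟩ : ∃ m, l = m + 1 := ⟨l - 1, by omega⟩
  rw [hm, Nat.add_sub_cancel] at h1
  have hn' : (2 : ℝ) ≤ n := by exact_mod_cast hn
  have h2 : (m : ℝ) * Real.log 2 ≤ 2 * Real.log 2 + Real.log n := by
    have h3 : (2 : ℝ) ^ m ≤ 2 ^ 2 * n := by
      have : ((2 ^ m : ℕ) : ℝ) ≤ (4 * n : ℕ) := by exact_mod_cast h1.le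
      push_cast at this
      linarith
    have h4 := Real.log_le_log (by positivity) h3
    rwa [Real.log_pow, Real.log_mul (by norm_num) (by positivity), Real.log_pow] at h4
  have h5 : Real.log 2 ≤ Real.log n := Real.log_le_log two_pos hn'
  have h6 := Real.log_two_gt_d9
  rw [hm]
  push_cast
  nlinarith

/-- A cutoff `k` for the width of the conjunctions balances both parts of the degree. -/
theorem exists_hasStrictPTF_conjCount {ι : Type*} (d n l : ℕ) (hn : 0 < n) (hl : 0 < l)
    (hnl : 4 * n ≤ 2 ^ l) (J : Finset ι) (S : ι → Finset (Fin d)) (hJ : J.card ≤ n) (θ : ℝ) :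
    ∃ a : ℕ, (a : ℝ) ≤ 14 * ((d : ℝ) ^ (1 / 3 : ℝ) * (l : ℝ) ^ (2 / 3 : ℝ)) ∧
      HasStrictPTF (fun q => θ ≤ conjCount J S q) a := by
  have hn' : (0 : ℝ) < n := by exact_mod_cast hn
  set x : ℝ := (d : ℝ) ^ (1 / 3 : ℝ) with hx
  set y : ℝ := (l : ℝ) ^ (1 / 3 : ℝ) with hy
  have hx0 : 0 ≤ x := by positivity
  have hy1 : 1 ≤ y := Real.one_le_rpow (by exact_mod_cast hl) (by norm_num)
  have hx3 : x ^ 3 = d := by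
    rw [hx, ← Real.rpow_natCast, ← Real.rpow_mul (Nat.cast_nonneg d)]; norm_num
  have hy3 : y ^ 3 = l := by
    rw [hy, ← Real.rpow_natCast, ← Real.rpow_mul (Nat.cast_nonneg l)]; norm_num
  have hy2 : (l : ℝ) ^ (2 / 3 : ℝ) = y ^ 2 := by
    rw [hy, ← Real.rpow_natCast, ← Real.rpow_mul (Nat.cast_nonneg l)]; norm_num
  rw [hy2]
  -- If d ≤ l, exact interpolation of degree d = x³ ≤ xy² suffices; otherwise l ≤ k ≤ d for the
  -- cutoff chosen below.
  rcases le_or_gt d l with hdl | hdl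
  · obtain ⟨p, hpd, hp0, hp⟩ := exists_poly_vanishing_on_range d
    refine ⟨p.natDegree, ?_, hasStrictPTF_of_approx n d hn p hp0 (fun x h0 h1 => ?_) J S hJ
      (fun j _ => (Finset.card_le_univ _).trans_eq (Fintype.card_fin d)) θ⟩
    · have hxy : x ≤ y := Real.rpow_le_rpow (by positivity) (by exact_mod_cast hdl) (by norm_num)
      have h1 : (p.natDegree : ℝ) ≤ x ^ 3 := by rw [hx3]; exact_mod_cast hpd
      have h2 : x ^ 2 ≤ y ^ 2 := by gcongr
      nlinarith [mul_le_mul_of_nonneg_left h2 hx0]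
    · rw [hp x h0 h1, abs_zero]; positivity
  have hyx : y ≤ x := Real.rpow_le_rpow (by positivity) (by exact_mod_cast hdl.le) (by norm_num)
  have hx1 : 1 ≤ x := hy1.trans hyx
  have hy0 : 0 < y := by linarith
  have hx0' : 0 < x := by linarith
  set k : ℕ := ⌈x ^ 2 * y⌉₊ with hk
  have hk1 : x ^ 2 * y ≤ k := Nat.le_ceil _
  have hk2 : (k : ℝ) ≤ 2 * (x ^ 2 * y) :=
    natCeil_le_two_mul (one_le_mul_of_one_le_of_one_le (one_le_pow₀ hx1) hy1)
  have hkd : k ≤ d := by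
    rw [hk, Nat.ceil_le, ← hx3]
    nlinarith [mul_le_mul_of_nonneg_left hyx (sq_nonneg x)]
  have hlk : l ≤ k := by
    have : (l : ℝ) ≤ k := by
      rw [← hy3]
      refine le_trans ?_ hk1
      calc y ^ 3 = y ^ 2 * y := by ring
        _ ≤ x ^ 2 * y := by gcongr
    exact_mod_cast this
  obtain ⟨p, hpd, hp0, hp⟩ := exists_disjunction_approx k l hl hlk
  -- This makes r·k ≥ x³y³ = d·l, so (1 - k/d)^r ≤ exp(-l) < 1/n.
  set r : ℕ := ⌈x * y ^ 2⌉₊ with hr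
  have hr1 : x * y ^ 2 ≤ r := Nat.le_ceil _
  have hr2 : (r : ℝ) ≤ 2 * (x * y ^ 2) :=
    natCeil_le_two_mul (one_le_mul_of_one_le_of_one_le hx1 (one_le_pow₀ hy1))
  have hd0 : (0 : ℝ) < d := by rw [← hx3]; positivity
  have hnl' : 4 * (n : ℝ) ≤ 2 ^ l := by exact_mod_cast hnl
  -- The constant is 14 = 2 + 6·2: r ≤ 2xy² and √(kl) ≤ 2xy².
  refine ⟨r + p.natDegree, ?_, ?_⟩
  · have h1 : √((k : ℝ) * l) ≤ 2 * (x * y ^ 2) := by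
      refine Real.sqrt_le_iff.2 ⟨by positivity, ?_⟩
      rw [← hy3]
      have h2 : (k : ℝ) * y ^ 3 ≤ 2 * (x ^ 2 * y) * y ^ 3 := by gcongr
      have h3 : 0 ≤ (x * y ^ 2) ^ 2 := sq_nonneg _
      nlinarith
    push_cast
    linarith
  · refine hasStrictPTF_of_short n k p.natDegree θ (fun J S hJ hS =>
      hasStrictPTF_of_approx n k hn p hp0 (fun x h0 h1 => (hp x h0 h1).trans ?_) J S hJ hS θ)
      _ J S r le_rfl hJ ?_
    · rw [one_div_pow]
      exact one_div_le_one_div_of_le (by positivity) hnl'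
    · have hc : ((J.filter fun j => k < (S j).card).card : ℝ) ≤ n := by
        exact_mod_cast (Finset.card_filter_le _ _).trans hJ
      have hρ : (0 : ℝ) ≤ 1 - k / d := by
        rw [sub_nonneg, div_le_one hd0]; exact_mod_cast hkd
      have h1 : (1 - (k : ℝ) / d) ^ r ≤ Real.exp (-l) := by
        calc (1 - (k : ℝ) / d) ^ r ≤ Real.exp (-(k / d)) ^ r :=
              pow_le_pow_left₀ hρ (Real.one_sub_le_exp_neg _) r
          _ = Real.exp (r * -(k / d)) := (Real.exp_nat_mul _ _).symm
          _ ≤ Real.exp (-l) := by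
            refine Real.exp_le_exp.2 ?_
            rw [mul_neg, neg_le_neg_iff, ← mul_div_assoc, le_div_iff₀ hd0, ← hx3, ← hy3]
            calc y ^ 3 * x ^ 3 = (x * y ^ 2) * (x ^ 2 * y) := by ring
              _ ≤ (r : ℝ) * k := by gcongr
      have h2 : (n : ℝ) < Real.exp l := by
        have h3 : (2 : ℝ) ^ l ≤ Real.exp 1 ^ l :=
          pow_le_pow_left₀ two_pos.le (by linarith [Real.exp_one_gt_d9]) l
        rw [← Real.exp_nat_mul, mul_one] at h3
        linarith
      calc _ ≤ (n : ℝ) * Real.exp (-l) := mul_le_mul hc h1 (pow_nonneg hρ _) hn'.le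
        _ < Real.exp l * Real.exp (-l) := by gcongr
        _ = 1 := by rw [← Real.exp_add, add_neg_cancel, Real.exp_zero]

theorem mainTheorem6 :
    ∃ C : ℝ, 0 < C ∧
      ∀ (d n : ℕ), 2 ≤ n →
        ∀ (D : Fin n → BoolCube d) (t : ℝ), t ∈ Set.Icc (0 : ℝ) 1 →
          ∃ a : ℕ,
            (a : ℝ) ≤ C * ((d : ℝ) ^ (1 / 3 : ℝ) * (Real.log (n : ℝ)) ^ (2 / 3 : ℝ)) ∧
            HasPTF (Set.univ : Set (BoolCube d))
              (thresholdQuery (monotoneConj (d := d)) D t) a := by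
  refine ⟨14 * 6 ^ (2 / 3 : ℝ), by positivity, fun d n hn D t _ => ?_⟩
  obtain ⟨a, ha, hf⟩ := exists_hasStrictPTF_conjCount d n (Nat.clog 2 (4 * n)) (by omega)
    (Nat.clog_pos one_lt_two (by omega)) (Nat.le_pow_clog one_lt_two _) Finset.univ
    (fun j : Fin n => Finset.univ.filter fun i => D j i = false) (by simp) (n * t)
  refine ⟨a, ha.trans ?_, ?_⟩
  · have hlog : 0 ≤ Real.log n := Real.log_natCast_nonneg n
    have h1 : (Nat.clog 2 (4 * n) : ℝ) ^ (2 / 3 : ℝ) ≤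
        6 ^ (2 / 3 : ℝ) * Real.log n ^ (2 / 3 : ℝ) := by
      rw [← Real.mul_rpow (by norm_num) hlog]
      exact Real.rpow_le_rpow (Nat.cast_nonneg _) (clog_four_mul_le n hn) (by norm_num)
    calc _ ≤ 14 * ((d : ℝ) ^ (1 / 3 : ℝ) *
          (6 ^ (2 / 3 : ℝ) * Real.log n ^ (2 / 3 : ℝ))) := by gcongr
      _ = _ := by ring
  · rw [thresholdQuery_eq (by omega) D t]
    classical
    convert hf.hasPTF Set.univ
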